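/- Let $N\ge 1$, $n,Q\in\mathbb N$, and let $\Omega\subset\mathbb R^N$ be an open set. Let $\mathcal A_Q(\mathbb R^n)$ be the space of unordered $Q$-tuples $T=\sum_{i=1}^Q[\![t_i]\!]$ of points of $\mathbb R^n$ with the metric $\mathcal G(S,T)^2=\min_{\sigma}\sum_{i=1}^Q|s_i-t_{\sigma(i)}|^2$, the minimum being over all permutations $\sigma$ of $\{1,\dots,Q\}$. For an open set $\Omega$, the space $W^{1,2}(\Omega,\mathcal A_Q(\mathbb R^n))$ consists of the measurable maps $u:\Omega\to\mathcal A_Q(\mathbb R^n)$ such that $\mathcal G(u,T)\in W^{1,2}(\Omega)$ for every $T\in\mathcal A_Q(\mathbb R^n)$ and such that for every coordinate direction $j$ there is $0\le\varphi_j\in L^2(\Omega)$ with $|D_j\mathcal G(u,T)|\le\varphi_j$ a.e. on $\Omega$ for every $T$. The a.e. smallest such $\varphi_j$ is denoted by $|D_ju|$, and $\int_\Omega|Du|^2=\int_\Omega\sum_j|D_ju|^2$. A map $u\in W^{1,2}(\Omega,\mathcal A_Q(\mathbb R^n))$ is Dirichlet minimizing on $\Omega$ if $$\int_\Omega|Du|^2=\inf\Big\{\int_\Omega|Dv|^2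 : v\in W^{1,2}(\Omega,\mathcal A_Q(\mathbb R^n)),\ \mathcal G(u,v)\in W^{1,2}_0(\Omega)\Big\},$$ where $W^{1,2}_0(\Omega)$ is the closure of $C_c^\infty(\Omega)$ in $W^{1,2}(\Omega)$. If $u\in W^{1,2}(\Omega,\mathcal A_Q(\mathbb R^n))$ is Dirichlet minimizing on $\Omega$, then for every bounded open interval $I=(a,b)\subset\mathbb R$, $a<b$, the map $U(x,t)=u(x)$ belongs to $W^{1,2}(\Omega\times I,\mathcal A_Q(\mathbb R^n))$ and is Dirichlet minimizing on $\Omega\times I\subset\mathbb R^{N+1}$. -/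

import Mathlib

open MeasureTheory Filter Topology
open scoped ContDiff

namespace QValued

/-- The Euclidean space `ℝ^N`. -/
abbrev Euc (N : ℕ) : Type := EuclideanSpace ℝ (Fin N)

/-! ### The metric space of unordered `Q`-tuples of points of `ℝ^n` -/

/-- Two ordered `Q`-tuples are identified when they differ by a permutation of the indices. -/
def tupleSetoid (Q n : ℕ) : Setoid (Fin Q → Euc n) where
  r s t := ∃ σ : Equiv.Perm (Fin Q), ∀ i, s (σ i) = t i
  iseqv :=
    { refl := fun _ => ⟨1, fun _ => rfl⟩
      symm := by
        rintro s t ⟨σ, h⟩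
        exact ⟨σ⁻¹, fun i => by rw [← h]; simp⟩
      trans := by
        rintro s t r ⟨σ, h⟩ ⟨τ, k⟩
        exact ⟨σ * τ, fun i => by rw [← k, ← h]; rfl⟩ }

/-- `A_Q(ℝ^n)`, the set of unordered `Q`-tuples `∑ i, ⟦t i⟧` of points of `ℝ^n`. -/
def AQ (Q n : ℕ) : Type := Quotient (tupleSetoid Q n)

/-- The unordered tuple `∑ i, ⟦t i⟧`. -/
def AQ.mk {Q n : ℕ} (t : Fin Q → Euc n) : AQ Q n := Quotient.mk (tupleSetoid Q n) t

/-- `√ (∑ i, |s i - t (σ i)|²)`. -/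
noncomputable def permDist {Q n : ℕ} (s t : Fin Q → Euc n) (σ : Equiv.Perm (Fin Q)) : ℝ :=
  Real.sqrt (∑ i, ‖s i - t (σ i)‖ ^ 2)

/-- `min_σ √ (∑ i, |s i - t (σ i)|²)` (an infimum over a finite nonempty set). -/
noncomputable def tupleDist {Q n : ℕ} (s t : Fin Q → Euc n) : ℝ :=
  ⨅ σ : Equiv.Perm (Fin Q), permDist s t σ

theorem permDist_nonneg {Q n : ℕ} (s t : Fin Q → Euc n) (σ : Equiv.Perm (Fin Q)) :
    0 ≤ permDist s t σ := Real.sqrt_nonneg _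

theorem permDist_eq_dist {Q n : ℕ} (s t : Fin Q → Euc n) (σ : Equiv.Perm (Fin Q)) :
    permDist s t σ
      = dist (WithLp.toLp 2 s : PiLp 2 fun _ : Fin Q => Euc n) (WithLp.toLp 2 fun i => t (σ i)) := by
  rw [PiLp.dist_eq_of_L2]
  simp [permDist, dist_eq_norm]

theorem permDist_comp {Q n : ℕ} (s t : Fin Q → Euc n) (τ σ : Equiv.Perm (Fin Q)) :
    permDist (fun i => s (τ i)) t σ = permDist s t (σ * τ⁻¹) := by
  unfold permDist
  congr 1
  rw [← Equiv.sum_comp τ (fun i => ‖s i - t ((σ * τ⁻¹) i)‖ ^ 2)]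
  simp

theorem permDist_symm {Q n : ℕ} (s t : Fin Q → Euc n) (σ : Equiv.Perm (Fin Q)) :
    permDist s t σ = permDist t s σ⁻¹ := by
  unfold permDist
  congr 1
  rw [← Equiv.sum_comp σ (fun i => ‖t i - s (σ⁻¹ i)‖ ^ 2)]
  simp [norm_sub_rev]

theorem permDist_triangle {Q n : ℕ} (s t r : Fin Q → Euc n) (σ τ : Equiv.Perm (Fin Q)) :
    permDist s r (τ * σ) ≤ permDist s t σ + permDist t r τ := by
  have h : permDist t r τ = permDist (fun i => t (σ i)) r (τ * σ) := by
    rw [permDist_comp]; simp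
  rw [h, permDist_eq_dist, permDist_eq_dist, permDist_eq_dist]
  exact dist_triangle _ _ _

theorem tupleDist_le {Q n : ℕ} (s t : Fin Q → Euc n) (σ : Equiv.Perm (Fin Q)) :
    tupleDist s t ≤ permDist s t σ := ciInf_le (Set.finite_range _).bddBelow σ

theorem exists_tupleDist {Q n : ℕ} (s t : Fin Q → Euc n) :
    ∃ σ : Equiv.Perm (Fin Q), permDist s t σ = tupleDist s t :=
  exists_eq_ciInf_of_finite

theorem tupleDist_comm {Q n : ℕ} (s t : Fin Q → Euc n) : tupleDist s t = tupleDist t s := by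
  refine le_antisymm ?_ ?_
  · obtain ⟨σ, h⟩ := exists_tupleDist t s
    rw [← h, permDist_symm]; exact tupleDist_le _ _ _
  · obtain ⟨σ, h⟩ := exists_tupleDist s t
    rw [← h, permDist_symm]; exact tupleDist_le _ _ _

theorem tupleDist_triangle {Q n : ℕ} (s t r : Fin Q → Euc n) :
    tupleDist s r ≤ tupleDist s t + tupleDist t r := by
  obtain ⟨σ, h⟩ := exists_tupleDist s t
  obtain ⟨τ, k⟩ := exists_tupleDist t r
  rw [← h, ← k]
  exact (tupleDist_le _ _ _).trans (permDist_triangle s t r σ τ)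

theorem tupleDist_eq_zero {Q n : ℕ} (s t : Fin Q → Euc n) :
    tupleDist s t = 0 ↔ (tupleSetoid Q n).r s t := by
  constructor
  · intro h0
    obtain ⟨σ, h⟩ := exists_tupleDist s t
    rw [h0, permDist_eq_dist, dist_eq_zero] at h
    refine ⟨σ⁻¹, fun i => ?_⟩
    have := congrFun (congrArg WithLp.ofLp h) (σ⁻¹ i)
    simpa using this
  · rintro ⟨σ, h⟩
    refine le_antisymm ((tupleDist_le s t σ⁻¹).trans (le_of_eq ?_))
      (Real.iInf_nonneg fun σ => permDist_nonneg s t σ)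
    simp [permDist, ← h]

theorem tupleDist_congr {Q n : ℕ} (s t s' t' : Fin Q → Euc n)
    (hs : (tupleSetoid Q n).r s s') (ht : (tupleSetoid Q n).r t t') :
    tupleDist s t = tupleDist s' t' := by
  have h1 := (tupleDist_eq_zero s s').2 hs
  have h2 := (tupleDist_eq_zero t t').2 ht
  have a1 := tupleDist_triangle s s' t
  have a2 := tupleDist_triangle s' t' t
  have a3 := tupleDist_triangle s' s t'
  have a4 := tupleDist_triangle s t t'
  rw [tupleDist_comm t' t] at a2
  rw [tupleDist_comm s' s] at a3
  linarith

/-- The metric `𝒢(S,T)² = min_σ ∑ i, |s i - t (σ i)|²` on `A_Q(ℝ^n)`. -/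
noncomputable def AQ.G {Q n : ℕ} (S T : AQ Q n) : ℝ :=
  Quotient.lift₂ tupleDist tupleDist_congr S T

noncomputable instance AQ.instMetricSpace (Q n : ℕ) : MetricSpace (AQ Q n) where
  dist := AQ.G
  dist_self S := by
    induction S using Quotient.inductionOn with
    | h s => exact (tupleDist_eq_zero s s).2 ((tupleSetoid Q n).iseqv.refl s)
  dist_comm S T := by
    induction S, T using Quotient.inductionOn₂ with
    | h s t => exact tupleDist_comm s t
  dist_triangle S T R := by
    induction S, T, R using Quotient.inductionOn₃ with
    | h s t r => exact tupleDist_triangle s t r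
  eq_of_dist_eq_zero {S T} h := by
    induction S, T using Quotient.inductionOn₂ with
    | h s t => exact Quotient.sound ((tupleDist_eq_zero s t).1 h)

/-! ### Real-valued Sobolev functions on `Ω ⊆ ℝ^N`

Functions on `Ω` are represented by functions on the whole of `ℝ^N`; all notions below depend only
on the restriction to `Ω`, up to Lebesgue null sets. -/

/-- `φ ∈ C_c^∞(Ω)`. -/
structure IsTest {N : ℕ} (Ω : Set (Euc N)) (φ : Euc N → ℝ) : Prop where
  smooth : ContDiff ℝ ∞ φ
  compact : HasCompactSupport φ
  support_subset : tsupport φ ⊆ Ω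

/-- The classical partial derivative `∂_j φ`. -/
noncomputable def partialDeriv {N : ℕ} (j : Fin N) (φ : Euc N → ℝ) (x : Euc N) : ℝ :=
  fderiv ℝ φ x (EuclideanSpace.single j 1)

/-- `g ∈ L²(Ω)` is the weak partial derivative `D_j f` of `f ∈ L²(Ω)` on `Ω`. -/
structure HasWeakPartial {N : ℕ} (Ω : Set (Euc N)) (f : Euc N → ℝ) (j : Fin N)
    (g : Euc N → ℝ) : Prop where
  memLp_fun : MemLp f 2 (volume.restrict Ω)
  memLp_deriv : MemLp g 2 (volume.restrict Ω)
  integral_eq : ∀ φ : Euc N → ℝ, IsTest Ω φ →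
    ∫ x in Ω, f x * partialDeriv j φ x = - ∫ x in Ω, g x * φ x

/-- `f ∈ W^{1,2}(Ω)`. -/
structure MemW12 {N : ℕ} (Ω : Set (Euc N)) (f : Euc N → ℝ) : Prop where
  memLp : MemLp f 2 (volume.restrict Ω)
  exists_weakPartial : ∀ j : Fin N, ∃ g : Euc N → ℝ, HasWeakPartial Ω f j g

/-- `f ∈ W_0^{1,2}(Ω)`: `f` lies in the closure of `C_c^∞(Ω)` in `W^{1,2}(Ω)`. -/
def MemW12Zero {N : ℕ} (Ω : Set (Euc N)) (f : Euc N → ℝ) : Prop :=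
  MemLp f 2 (volume.restrict Ω) ∧
  ∃ g : Fin N → Euc N → ℝ, (∀ j, HasWeakPartial Ω f j (g j)) ∧
    ∃ φ : ℕ → Euc N → ℝ, (∀ k, IsTest Ω (φ k)) ∧
      Tendsto (fun k => eLpNorm (fun x => φ k x - f x) 2 (volume.restrict Ω)) atTop (𝓝 0) ∧
      ∀ j, Tendsto
        (fun k => eLpNorm (fun x => partialDeriv j (φ k) x - g j x) 2 (volume.restrict Ω))
        atTop (𝓝 0)

/-! ### `Q`-valued Sobolev functions and the Dirichlet energy -/

/-- `φ ∈ L²(Ω, ℝ_+)` satisfies `|D_j 𝒢(u, T)| ≤ φ` a.e. on `Ω`, for every `T ∈ A_Q(ℝ^n)`. -/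
structure IsPartialBound {N Q n : ℕ} (Ω : Set (Euc N)) (u : Euc N → AQ Q n) (j : Fin N)
    (φ : Euc N → ℝ) : Prop where
  memLp : MemLp φ 2 (volume.restrict Ω)
  nonneg : ∀ᵐ x ∂(volume.restrict Ω), 0 ≤ φ x
  bound : ∀ T : AQ Q n, ∃ g : Euc N → ℝ, HasWeakPartial Ω (fun x => AQ.G (u x) T) j g ∧
    ∀ᵐ x ∂(volume.restrict Ω), |g x| ≤ φ x

/-- `u ∈ W^{1,2}(Ω, A_Q(ℝ^n))`. -/
structure MemW12Q {N Q n : ℕ} (Ω : Set (Euc N)) (u : Euc N → AQ Q n) : Prop where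
  measurable : AEStronglyMeasurable u (volume.restrict Ω)
  memW12 : ∀ T : AQ Q n, MemW12 Ω (fun x => AQ.G (u x) T)
  exists_bound : ∀ j : Fin N, ∃ φ : Euc N → ℝ, IsPartialBound Ω u j φ

/-- `φ` is the a.e. smallest of the bounds for the `j`-th partial derivative of `u`. -/
structure IsMinimalPartialBound {N Q n : ℕ} (Ω : Set (Euc N)) (u : Euc N → AQ Q n) (j : Fin N)
    (φ : Euc N → ℝ) : Prop where
  isBound : IsPartialBound Ω u j φ
  minimal : ∀ ψ : Euc N → ℝ, IsPartialBound Ω u j ψ → ∀ᵐ x ∂(volume.restrict Ω), φ x ≤ ψ x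

open Classical in
/-- `|D_j u|`, the minimal bound; it is unique up to null sets, and exists for every
`u ∈ W^{1,2}(Ω, A_Q(ℝ^n))` on an open set `Ω`. -/
noncomputable def normPartial {N Q n : ℕ} (Ω : Set (Euc N)) (u : Euc N → AQ Q n) (j : Fin N) :
    Euc N → ℝ :=
  if h : ∃ φ : Euc N → ℝ, IsMinimalPartialBound Ω u j φ then h.choose else 0

/-- The Dirichlet energy `∫_Ω |Du|² = ∫_Ω ∑ j, |D_j u|²`. -/
noncomputable def energy {N Q n : ℕ} (Ω : Set (Euc N)) (u : Euc N → AQ Q n) : ℝ :=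
  ∫ x in Ω, ∑ j, normPartial Ω u j x ^ 2

/-- `u ∈ W^{1,2}(Ω, A_Q(ℝ^n))` is Dirichlet minimizing: its energy is the infimum of the energies of
all `v ∈ W^{1,2}(Ω, A_Q(ℝ^n))` with `𝒢(u, v) ∈ W_0^{1,2}(Ω)`. -/
structure IsDirichletMinimizing {N Q n : ℕ} (Ω : Set (Euc N)) (u : Euc N → AQ Q n) : Prop where
  memW12Q : MemW12Q Ω u
  isGLB : IsGLB {e : ℝ | ∃ v : Euc N → AQ Q n, MemW12Q Ω v ∧
    MemW12Zero Ω (fun x => AQ.G (u x) (v x)) ∧ e = energy Ω v} (energy Ω u)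

/-! ### Cylinders -/

/-- The projection `ℝ^{N+1} = ℝ^N × ℝ → ℝ^N`, `(x, t) ↦ x`. -/
def spacePart {N : ℕ} (z : Euc (N + 1)) : Euc N := WithLp.toLp 2 fun i => z i.castSucc

/-- The cylinder `Ω × I ⊆ ℝ^N × ℝ = ℝ^{N+1}`. -/
def cylinder {N : ℕ} (Ω : Set (Euc N)) (I : Set ℝ) : Set (Euc (N + 1)) :=
  {z | spacePart z ∈ Ω ∧ z (Fin.last N) ∈ I}

/-- `U(x, t) = u(x)`. -/
def lift {N Q n : ℕ} (u : Euc N → AQ Q n) : Euc (N + 1) → AQ Q n := fun z => u (spacePart z)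

end QValued

/-! The proof slices the cylinder at fixed t. Since U does not depend on t, the functions |D_j u|
bound its spatial derivatives and 0 bounds its t-derivative, so the energy of U is at most |I| times
that of u (`MemW12Q.energy_lift_le`).

Conversely, let V be a competitor on Ω × I. For a.e. t the slice V(·, t) is a Sobolev map on Ω whose
partial derivatives are bounded by the slices of |D_j V| (`MemW12Q.slice`), and 𝒢(u, V(·, t)) lies
in W_0^{1,2}(Ω) (`MemW12Zero.slice`). Minimality of u bounds the spatial energy of each such slice
below by the energy of u. Integrating in t and discarding |D_t V|² gives |I| E(u) ≤ E(V)
(`IsDirichletMinimizing.le_energy_cylinder`). Hence E(U) ≤ E(V), and U is itself a competitor.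

The difficulty is in "almost every t": the definitions quantify over uncountably many test functions
and tuples T. Separability of L² reduces the former to a countable family
(`exists_countable_isTest`); separability of the space of tuples, together with weak compactness in
L², does the same for the latter (`IsPartialBound.of_dense`). -/

namespace QValued

/-! ### Separability of the space of tuples -/

section Tuples

variable {Q n : ℕ}

theorem AQ.continuous_mk : Continuous (AQ.mk : (Fin Q → Euc n) → AQ Q n) := by
  have h : LipschitzWith 1 fun s : PiLp 2 fun _ : Fin Q => Euc n => AQ.mk s.ofLp := by
    refine LipschitzWith.of_dist_le_mul fun s t => ?_
    have := (tupleDist_le s.ofLp t.ofLp 1).trans_eq (permDist_eq_dist _ _ _)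
    rw [NNReal.coe_one, one_mul]
    exact this
  exact h.continuous.comp (PiLp.continuous_toLp 2 _)

instance AQ.instSeparableSpace : TopologicalSpace.SeparableSpace (AQ Q n) :=
  have h : Function.Surjective (AQ.mk : (Fin Q → Euc n) → AQ Q n) := Quotient.mk_surjective
  h.denseRange.separableSpace AQ.continuous_mk

instance AQ.instNonempty : Nonempty (AQ Q n) := ⟨AQ.mk fun _ => 0⟩

theorem AQ.G_eq_dist (S T : AQ Q n) : AQ.G S T = dist S T := rfl

theorem AQ.G_self (S : AQ Q n) : AQ.G S S = 0 := dist_self S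

theorem AQ.G_nonneg (S T : AQ Q n) : 0 ≤ AQ.G S T := dist_nonneg (x := S) (y := T)

theorem AQ.abs_G_sub_G_le (S T T' : AQ Q n) : |AQ.G S T - AQ.G S T'| ≤ AQ.G T T' := by
  simp only [AQ.G_eq_dist, dist_comm S]
  exact abs_dist_sub_le T T' S

end Tuples

/-! ### Weak compactness in L² -/

section WeakLimit

variable {α : Type*} [MeasurableSpace α] {μ : Measure α}

/-- A sequence in a Hilbert space with bounded norms converges weakly along some ultrafilter. -/
theorem exists_ultrafilter_tendsto_inner {H : Type*} [NormedAddCommGroup H] [InnerProductSpace ℝ H]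
    [CompleteSpace H] (g : ℕ → H) (C : ℝ) (hg : ∀ k, ‖g k‖ ≤ C) :
    ∃ (l : Ultrafilter ℕ) (w : H), (l : Filter ℕ) ≤ atTop ∧
      ∀ h : H, Tendsto (fun k => inner ℝ (g k) h) l (𝓝 (inner ℝ w h)) := by
  -- Banach–Alaoglu in the dual, transported by the Riesz isometry. Ultrafilter limits avoid
  -- extracting a subsequence.
  have hc := WeakDual.isCompact_closedBall (0 : StrongDual ℝ H) C
  set F : ℕ → WeakDual ℝ H := fun k =>
    StrongDual.toWeakDual (InnerProductSpace.toDual ℝ H (g k)) with hF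
  have hmem : ∀ k, F k ∈ WeakDual.toStrongDual ⁻¹' Metric.closedBall (0 : StrongDual ℝ H) C := by
    intro k
    simpa [hF] using hg k
  obtain ⟨x, -, hx⟩ := hc.ultrafilter_le_nhds (Ultrafilter.map F (hyperfilter ℕ))
    (le_principal_iff.2 (Filter.mem_map.2 (Filter.univ_mem' hmem)))
  refine ⟨hyperfilter ℕ, (InnerProductSpace.toDual ℝ H).symm (WeakDual.toStrongDual x),
    Nat.hyperfilter_le_atTop, fun h => ?_⟩
  have h1 : Tendsto F (hyperfilter ℕ) (𝓝 x) := hx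
  have h2 := ((WeakDual.eval_continuous (𝕜 := ℝ) h).tendsto x).comp h1
  simpa [hF, Function.comp_def] using h2

/-- A sequence of functions dominated by `φ ∈ L²` converges weakly in `L²` along some ultrafilter,
and the weak limit is dominated by `φ`. -/
theorem exists_weakLimit_of_abs_le [SigmaFinite μ] {g : ℕ → α → ℝ} {φ : α → ℝ}
    (hg : ∀ k, MemLp (g k) 2 μ) (hφ : MemLp φ 2 μ) (hle : ∀ k, ∀ᵐ x ∂μ, |g k x| ≤ φ x) :
    ∃ (l : Ultrafilter ℕ) (w : α → ℝ), (l : Filter ℕ) ≤ atTop ∧ MemLp w 2 μ ∧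
      (∀ᵐ x ∂μ, |w x| ≤ φ x) ∧
      ∀ h : α → ℝ, MemLp h 2 μ →
        Tendsto (fun k => ∫ x, g k x * h x ∂μ) l (𝓝 (∫ x, w x * h x ∂μ)) := by
  have hb : ∀ k, ‖(hg k).toLp (g k)‖ ≤ ‖hφ.toLp φ‖ := by
    intro k
    refine Lp.norm_le_norm_of_ae_le ?_
    filter_upwards [(hg k).coeFn_toLp, hφ.coeFn_toLp, hle k] with x h1 h2 h3
    rw [h1, h2]
    exact h3.trans (le_abs_self _)
  obtain ⟨l, w, hl, hw⟩ := exists_ultrafilter_tendsto_inner _ _ hb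
  have key : ∀ h : α → ℝ, MemLp h 2 μ →
      Tendsto (fun k => ∫ x, g k x * h x ∂μ) l (𝓝 (∫ x, w x * h x ∂μ)) := by
    intro h hh
    have e : ∀ v : Lp ℝ 2 μ, inner ℝ v (hh.toLp h) = ∫ x, v x * h x ∂μ := by
      intro v
      rw [L2.inner_def]
      refine integral_congr_ae ?_
      filter_upwards [hh.coeFn_toLp] with x hx
      rw [hx]
      simp [mul_comm]
    have := hw (hh.toLp h)
    simp only [e] at this
    convert this using 2 with k
    refine integral_congr_ae ?_
    filter_upwards [(hg k).coeFn_toLp] with x hx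
    rw [hx]
  have hwm := Lp.memLp w
  -- Testing weak convergence against indicators of sets of finite measure passes the bounds ±φ to
  -- the limit in integrated form; this suffices for the pointwise bound.
  have hset : ∀ s, MeasurableSet s → μ s < ⊤ →
      ∫ x in s, w x ∂μ ≤ ∫ x in s, φ x ∂μ ∧ -∫ x in s, φ x ∂μ ≤ ∫ x in s, w x ∂μ := by
    intro s hs hμ
    have hi : MemLp (s.indicator fun _ => (1 : ℝ)) 2 μ :=
      memLp_indicator_const 2 hs 1 (Or.inr hμ.ne)
    have e : ∀ v : α → ℝ, ∫ x, v x * s.indicator (fun _ => (1 : ℝ)) x ∂μ = ∫ x in s, v x ∂μ := by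
      intro v
      rw [← integral_indicator hs]
      congr 1 with x
      by_cases hx : x ∈ s <;> simp [hx]
    have ht := key _ hi
    simp only [e] at ht
    have : IsFiniteMeasure (μ.restrict s) := ⟨by simpa using hμ⟩
    have hφi : IntegrableOn φ s μ := (hφ.restrict s).integrable one_le_two
    have hgi : ∀ k, IntegrableOn (g k) s μ := fun k => ((hg k).restrict s).integrable one_le_two
    constructor
    · refine le_of_tendsto ht (Eventually.of_forall fun k => ?_)
      refine integral_mono_ae (hgi k) hφi ?_
      filter_upwards [ae_restrict_of_ae (hle k)] with x hx using (abs_le.1 hx).2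
    · refine ge_of_tendsto ht (Eventually.of_forall fun k => ?_)
      rw [← integral_neg]
      refine integral_mono_ae hφi.neg (hgi k) ?_
      filter_upwards [ae_restrict_of_ae (hle k)] with x hx using (abs_le.1 hx).1
  have hint : ∀ v : α → ℝ, MemLp v 2 μ → ∀ s, MeasurableSet s → μ s < ⊤ →
      IntegrableOn v s μ := by
    intro v hv s _ hμ
    have : IsFiniteMeasure (μ.restrict s) := ⟨by simpa using hμ⟩
    exact (hv.restrict s).integrable one_le_two
  refine ⟨l, w, hl, hwm, ?_, key⟩
  have h1 : 0 ≤ᵐ[μ] fun x => φ x - w x := by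
    refine ae_nonneg_of_forall_setIntegral_nonneg_of_sigmaFinite
      (fun s hs hμ => (hint _ hφ s hs hμ).sub (hint _ hwm s hs hμ)) fun s hs hμ => ?_
    rw [integral_sub (hint _ hφ s hs hμ) (hint _ hwm s hs hμ)]
    linarith [(hset s hs hμ).1]
  have h2 : 0 ≤ᵐ[μ] fun x => φ x + w x := by
    refine ae_nonneg_of_forall_setIntegral_nonneg_of_sigmaFinite
      (fun s hs hμ => (hint _ hφ s hs hμ).add (hint _ hwm s hs hμ)) fun s hs hμ => ?_
    rw [integral_add (hint _ hφ s hs hμ) (hint _ hwm s hs hμ)]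
    linarith [(hset s hs hμ).2]
  filter_upwards [h1, h2] with x hx1 hx2
  simp only [Pi.zero_apply] at hx1 hx2
  exact abs_le.2 ⟨by linarith, by linarith⟩

end WeakLimit

/-! ### Weak partial derivatives: uniqueness and closure under limits -/

section WeakPartial

variable {N : ℕ} {Ω : Set (Euc N)} {φ f g : Euc N → ℝ} {j : Fin N}

theorem IsTest.continuous_partialDeriv (hφ : IsTest Ω φ) (j : Fin N) :
    Continuous (partialDeriv j φ) :=
  (hφ.smooth.continuous_fderiv (by simp)).clm_apply continuous_const

theorem IsTest.hasCompactSupport_partialDeriv (hφ : IsTest Ω φ) (j : Fin N) :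
    HasCompactSupport (partialDeriv j φ) :=
  hφ.compact.fderiv_apply ℝ _

theorem IsTest.memLp (hφ : IsTest Ω φ) (p : ENNReal) (μ : Measure (Euc N))
    [IsFiniteMeasureOnCompacts μ] : MemLp φ p μ :=
  hφ.smooth.continuous.memLp_of_hasCompactSupport hφ.compact

theorem IsTest.memLp_partialDeriv (hφ : IsTest Ω φ) (j : Fin N) (p : ENNReal)
    (μ : Measure (Euc N)) [IsFiniteMeasureOnCompacts μ] : MemLp (partialDeriv j φ) p μ :=
  (hφ.continuous_partialDeriv j).memLp_of_hasCompactSupport (hφ.hasCompactSupport_partialDeriv j)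

theorem IsTest.eq_zero_of_notMem (hφ : IsTest Ω φ) {x : Euc N} (hx : x ∉ Ω) : φ x = 0 :=
  image_eq_zero_of_notMem_tsupport fun h => hx (hφ.support_subset h)

/-- Fundamental lemma of the calculus of variations, applied to g - g'. -/
theorem HasWeakPartial.ae_eq {g' : Euc N → ℝ} (hΩ : IsOpen Ω) (h : HasWeakPartial Ω f j g)
    (h' : HasWeakPartial Ω f j g') : g =ᵐ[volume.restrict Ω] g' := by
  have hm : MemLp (fun x => g x - g' x) 2 (volume.restrict Ω) := h.memLp_deriv.sub h'.memLp_deriv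
  have hloc : LocallyIntegrableOn (fun x => g x - g' x) Ω volume :=
    locallyIntegrableOn_of_locallyIntegrable_restrict (hm.locallyIntegrable one_le_two)
  have := hΩ.ae_eq_zero_of_integral_contDiff_smul_eq_zero hloc fun ψ hψ hc hs => by
    have ht : IsTest Ω ψ := ⟨hψ, hc, hs⟩
    rw [← setIntegral_eq_integral_of_forall_compl_eq_zero (s := Ω)
      fun x hx => by rw [ht.eq_zero_of_notMem hx, zero_smul]]
    have e := (h.integral_eq ψ ht).symm.trans (h'.integral_eq ψ ht)
    have hi := h.memLp_deriv.integrable_mul (ht.memLp 2 (volume.restrict Ω))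
    have hi' := h'.memLp_deriv.integrable_mul (ht.memLp 2 (volume.restrict Ω))
    calc ∫ x in Ω, ψ x • (g x - g' x) = ∫ x in Ω, (g x * ψ x - g' x * ψ x) := by
          congr 1 with x; simp only [smul_eq_mul]; ring
      _ = (∫ x in Ω, g x * ψ x) - ∫ x in Ω, g' x * ψ x := integral_sub hi hi'
      _ = 0 := by linarith
  rw [EventuallyEq, ae_restrict_iff' hΩ.measurableSet]
  filter_upwards [this] with x hx hxΩ using sub_eq_zero.1 (hx hxΩ)

/-- A uniform limit of functions whose weak partial derivatives are dominated by `φ ∈ L²` has a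
weak partial derivative dominated by `φ`. -/
theorem HasWeakPartial.exists_of_uniform_limit {f' g' : ℕ → Euc N → ℝ} {δ : ℕ → ℝ}
    (hf' : ∀ k, HasWeakPartial Ω (f' k) j (g' k)) (hφ : MemLp φ 2 (volume.restrict Ω))
    (hle : ∀ k, ∀ᵐ x ∂(volume.restrict Ω), |g' k x| ≤ φ x)
    (hf : MemLp f 2 (volume.restrict Ω)) (hδ : Tendsto δ atTop (𝓝 0))
    (hfδ : ∀ k x, |f' k x - f x| ≤ δ k) :
    ∃ w, HasWeakPartial Ω f j w ∧ ∀ᵐ x ∂(volume.restrict Ω), |w x| ≤ φ x := by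
  obtain ⟨l, w, hl, hw, hwφ, hlim⟩ :=
    exists_weakLimit_of_abs_le (fun k => (hf' k).memLp_deriv) hφ hle
  refine ⟨w, ⟨hf, hw, fun ψ hψ => ?_⟩, hwφ⟩
  have h1 := (hlim ψ (hψ.memLp 2 _)).neg
  have h2 : Tendsto (fun k => ∫ x in Ω, f' k x * partialDeriv j ψ x) l
      (𝓝 (∫ x in Ω, f x * partialDeriv j ψ x)) := by
    have hi1 : Integrable (partialDeriv j ψ) (volume.restrict Ω) :=
      memLp_one_iff_integrable.1 (hψ.memLp_partialDeriv j 1 _)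
    have hm := hψ.memLp_partialDeriv j 2 (volume.restrict Ω)
    refine Tendsto.mono_left ?_ hl
    rw [tendsto_iff_norm_sub_tendsto_zero]
    refine squeeze_zero (fun _ => norm_nonneg _) (fun k => ?_)
      (g := fun k => δ k * ∫ x in Ω, |partialDeriv j ψ x|) (by simpa using hδ.mul_const _)
    have hs := integral_sub ((hf' k).memLp_fun.integrable_mul hm) (hf.integrable_mul hm)
    simp only [Pi.mul_apply] at hs
    rw [← hs, ← integral_const_mul]
    refine norm_integral_le_of_norm_le (hi1.abs.const_mul _) (Eventually.of_forall fun x => ?_)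
    rw [← sub_mul, norm_mul, Real.norm_eq_abs, Real.norm_eq_abs]
    exact mul_le_mul_of_nonneg_right (hfδ k x) (abs_nonneg _)
  refine tendsto_nhds_unique h2 (h1.congr fun k => ?_)
  exact ((hf' k).integral_eq ψ hψ).symm

end WeakPartial

/-! ### Minimal bounds and the energy -/

section PartialBound

variable {N Q n : ℕ} {Ω : Set (Euc N)} {u : Euc N → AQ Q n} {j : Fin N} {φ : Euc N → ℝ}

/-- To bound `|D_j 𝒢(u, T)|` for every `T` it suffices to bound it for `T` in a dense set. -/
theorem IsPartialBound.of_dense {D : Set (AQ Q n)} (hD : Dense D)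
    (hu : ∀ T : AQ Q n, MemLp (fun x => AQ.G (u x) T) 2 (volume.restrict Ω))
    (hφ : MemLp φ 2 (volume.restrict Ω)) (hφ0 : ∀ᵐ x ∂(volume.restrict Ω), 0 ≤ φ x)
    (hb : ∀ T ∈ D, ∃ g, HasWeakPartial Ω (fun x => AQ.G (u x) T) j g ∧
      ∀ᵐ x ∂(volume.restrict Ω), |g x| ≤ φ x) :
    IsPartialBound Ω u j φ := by
  refine ⟨hφ, hφ0, fun T => ?_⟩
  obtain ⟨S, hSD, hS⟩ := mem_closure_iff_seq_limit.1 (hD T)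
  choose g hg hgφ using fun k => hb (S k) (hSD k)
  -- By the triangle inequality 𝒢(u, S k) → 𝒢(u, T) uniformly in x, at rate 𝒢(S k, T).
  exact HasWeakPartial.exists_of_uniform_limit (δ := fun k => AQ.G (S k) T) hg hφ hgφ (hu T)
    (tendsto_iff_dist_tendsto_zero.1 hS) fun k x => AQ.abs_G_sub_G_le _ _ _

/-- The minimal bound is the supremum of |D_j 𝒢(u, T)| over a dense sequence of T. Countability
keeps the exceptional sets null, any given bound makes the supremum finite a.e. and square
integrable, and density extends the bound to all T. -/
theorem MemW12Q.exists_isMinimalPartialBound (hΩ : IsOpen Ω) (hu : MemW12Q Ω u) (j : Fin N) :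
    ∃ φ, IsMinimalPartialBound Ω u j φ := by
  obtain ⟨φ, hφ⟩ := hu.exists_bound j
  choose g hg using fun T : AQ Q n => (hu.memW12 T).exists_weakPartial j
  set S := TopologicalSpace.denseSeq (AQ Q n) with hS
  have hle : ∀ ψ, IsPartialBound Ω u j ψ →
      ∀ᵐ x ∂(volume.restrict Ω), ∀ k, |g (S k) x| ≤ ψ x := by
    intro ψ hψ
    rw [ae_all_iff]
    intro k
    obtain ⟨h, hh, hhψ⟩ := hψ.bound (S k)
    filter_upwards [(hg (S k)).ae_eq hΩ hh, hhψ] with x h1 h2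
    rwa [h1]
  have hm : MemLp (fun x => ⨆ k, |g (S k) x|) 2 (volume.restrict Ω) := by
    refine hφ.memLp.mono
      (AEMeasurable.iSup fun k =>
        (hg (S k)).memLp_deriv.aestronglyMeasurable.aemeasurable.abs).aestronglyMeasurable ?_
    filter_upwards [hle φ hφ] with x hx
    rw [Real.norm_eq_abs, Real.norm_eq_abs, abs_of_nonneg (Real.iSup_nonneg fun k => abs_nonneg _)]
    exact (ciSup_le hx).trans (le_abs_self _)
  refine ⟨_, IsPartialBound.of_dense (TopologicalSpace.denseRange_denseSeq (AQ Q n))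
    (fun T => (hu.memW12 T).memLp) hm
    (Eventually.of_forall fun x => Real.iSup_nonneg fun k => abs_nonneg _) ?_, ?_⟩
  · rintro _ ⟨k, rfl⟩
    refine ⟨_, hg (S k), ?_⟩
    filter_upwards [hle φ hφ] with x hx
    exact le_ciSup (f := fun k => |g (S k) x|) ⟨φ x, by rintro _ ⟨i, rfl⟩; exact hx i⟩ k
  · intro ψ hψ
    filter_upwards [hle ψ hψ] with x hx
    exact ciSup_le hx

theorem MemW12Q.isMinimalPartialBound_normPartial (hΩ : IsOpen Ω) (hu : MemW12Q Ω u) (j : Fin N) :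
    IsMinimalPartialBound Ω u j (normPartial Ω u j) := by
  have h := hu.exists_isMinimalPartialBound hΩ j
  rw [normPartial, dif_pos h]
  exact h.choose_spec

/-- Ensures that `energy` is a genuine integral and not the default value 0, so that it can be
compared monotonically. -/
theorem MemW12Q.integrable_energy (hΩ : IsOpen Ω) (hu : MemW12Q Ω u) :
    Integrable (fun x => ∑ j, normPartial Ω u j x ^ 2) (volume.restrict Ω) :=
  integrable_finsetSum _ fun j _ =>
    (hu.isMinimalPartialBound_normPartial hΩ j).isBound.memLp.integrable_sq

/-- Any partial bounds give an upper bound for the energy. -/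
theorem MemW12Q.energy_le (hΩ : IsOpen Ω) (hu : MemW12Q Ω u) {ψ : Fin N → Euc N → ℝ}
    (hψ : ∀ j, IsPartialBound Ω u j (ψ j)) : energy Ω u ≤ ∫ x in Ω, ∑ j, ψ j x ^ 2 := by
  refine integral_mono_ae (hu.integrable_energy hΩ)
    (integrable_finsetSum _ fun j _ => (hψ j).memLp.integrable_sq) ?_
  have h1 := ae_all_iff.2 fun j => (hu.isMinimalPartialBound_normPartial hΩ j).minimal _ (hψ j)
  have h2 := ae_all_iff.2 fun j => (hu.isMinimalPartialBound_normPartial hΩ j).isBound.nonneg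
  filter_upwards [h1, h2] with x hx1 hx2
  exact Finset.sum_le_sum fun j _ => pow_le_pow_left₀ (hx2 j) (hx1 j) 2

end PartialBound

theorem integrable_mul_of_memLp_two {α : Type*} [MeasurableSpace α] {μ : Measure α} {f g : α → ℝ}
    (hf : MemLp f 2 μ) (hg : MemLp g 2 μ) : Integrable (fun x => f x * g x) μ :=
  hf.integrable_mul hg

/-! ### The cylinder as a product measure space -/

section Join

variable {N : ℕ}

/-- The volume preserving identification `ℝ × ℝ^N ≃ ℝ^{N+1}`, `(t, x) ↦ (x, t)`. -/
noncomputable def joinEquiv (N : ℕ) : ℝ × Euc N ≃ᵐ Euc (N + 1) :=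
  ((MeasurableEquiv.refl ℝ).prodCongr (MeasurableEquiv.toLp 2 (Fin N → ℝ)).symm).trans
    ((MeasurableEquiv.piFinSuccAbove (fun _ => ℝ) (Fin.last N)).symm.trans
      (MeasurableEquiv.toLp 2 (Fin (N + 1) → ℝ)))

/-- The point `(x, t)` of `ℝ^{N+1}`. -/
noncomputable def join (t : ℝ) (x : Euc N) : Euc (N + 1) := joinEquiv N (t, x)

theorem join_castSucc (t : ℝ) (x : Euc N) (i : Fin N) : join t x i.castSucc = x i := by
  have h : join t x i.castSucc
      = Fin.insertNth (α := fun _ => ℝ) (Fin.last N) t x.ofLp i.castSucc := rfl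
  rw [h, ← Fin.succAbove_last, Fin.insertNth_apply_succAbove]

theorem join_last (t : ℝ) (x : Euc N) : join t x (Fin.last N) = t := by
  have h : join t x (Fin.last N)
      = Fin.insertNth (α := fun _ => ℝ) (Fin.last N) t x.ofLp (Fin.last N) := rfl
  rw [h, Fin.insertNth_apply_same]

theorem spacePart_join (t : ℝ) (x : Euc N) : spacePart (join t x) = x := by
  ext i
  exact join_castSucc t x i

theorem join_spacePart (z : Euc (N + 1)) : join (z (Fin.last N)) (spacePart z) = z := by
  ext i
  induction i using Fin.lastCases with
  | last => exact join_last _ _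
  | cast i => exact join_castSucc _ _ i

theorem join_mem_cylinder {Ω : Set (Euc N)} {I : Set ℝ} {t : ℝ} {x : Euc N} :
    join t x ∈ cylinder Ω I ↔ t ∈ I ∧ x ∈ Ω := by
  simp only [cylinder, Set.mem_ofPred_eq, spacePart_join, join_last]
  exact and_comm

theorem contDiff_spacePart : ContDiff ℝ ∞ (spacePart : Euc (N + 1) → Euc N) :=
  contDiff_euclidean.2 fun i => (contDiff_euclidean.1 contDiff_id) i.castSucc

theorem continuous_apply_last : Continuous fun z : Euc (N + 1) => z (Fin.last N) :=
  (PiLp.continuous_apply 2 _ _)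

theorem contDiff_join : ContDiff ℝ ∞ fun p : ℝ × Euc N => join p.1 p.2 := by
  refine contDiff_euclidean.2 fun i => ?_
  induction i using Fin.lastCases with
  | last => simpa only [join_last] using contDiff_fst
  | cast i =>
    simp only [join_castSucc]
    exact (contDiff_euclidean.1 contDiff_snd) i

theorem measurePreserving_joinEquiv (N : ℕ) :
    MeasurePreserving (joinEquiv N) ((volume : Measure ℝ).prod (volume : Measure (Euc N)))
      volume := by
  refine MeasurePreserving.trans (μb := (volume : Measure (ℝ × (Fin N → ℝ)))) ?_
    (MeasurePreserving.trans (μb := (volume : Measure (Fin (N + 1) → ℝ))) ?_ ?_)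
  · exact (MeasurePreserving.id volume).prod
      (EuclideanSpace.volume_preserving_symm_measurableEquiv_toLp (Fin N))
  · exact (volume_preserving_piFinSuccAbove (fun _ => ℝ) (Fin.last N)).symm
  · exact (EuclideanSpace.volume_preserving_symm_measurableEquiv_toLp (Fin (N + 1))).symm

theorem measurePreserving_joinEquiv_restrict (Ω : Set (Euc N)) (I : Set ℝ) :
    MeasurePreserving (joinEquiv N) ((volume.restrict I).prod (volume.restrict Ω))
      (volume.restrict (cylinder Ω I)) := by
  have h := (measurePreserving_joinEquiv N).restrict_preimage_emb
    (joinEquiv N).measurableEmbedding (cylinder Ω I)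
  have e : joinEquiv N ⁻¹' cylinder Ω I = I ×ˢ Ω := by
    ext p
    exact join_mem_cylinder
  rwa [e, ← Measure.prod_restrict] at h

theorem isOpen_cylinder {Ω : Set (Euc N)} {I : Set ℝ} (hΩ : IsOpen Ω) (hI : IsOpen I) :
    IsOpen (cylinder Ω I) :=
  (hΩ.preimage contDiff_spacePart.continuous).inter
    (hI.preimage continuous_apply_last)

variable {Ω : Set (Euc N)} {I : Set ℝ}

theorem integral_cylinder (F : Euc (N + 1) → ℝ) :
    ∫ z in cylinder Ω I, F z
      = ∫ p, F (join p.1 p.2) ∂((volume.restrict I).prod (volume.restrict Ω)) :=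
  ((measurePreserving_joinEquiv_restrict Ω I).integral_comp
    (joinEquiv N).measurableEmbedding F).symm

theorem integrable_cylinder_iff {F : Euc (N + 1) → ℝ} :
    Integrable F (volume.restrict (cylinder Ω I)) ↔
      Integrable (fun p : ℝ × Euc N => F (join p.1 p.2))
        ((volume.restrict I).prod (volume.restrict Ω)) :=
  ((measurePreserving_joinEquiv_restrict Ω I).integrable_comp_emb
    (joinEquiv N).measurableEmbedding).symm

theorem integral_cylinder_eq_integral_integral {F : Euc (N + 1) → ℝ}
    (hF : Integrable F (volume.restrict (cylinder Ω I))) :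
    ∫ z in cylinder Ω I, F z = ∫ t in I, ∫ x in Ω, F (join t x) := by
  rw [integral_cylinder, integral_prod _ (integrable_cylinder_iff.1 hF)]

theorem memLp_cylinder_iff {F : Euc (N + 1) → ℝ} {p : ENNReal} :
    MemLp F p (volume.restrict (cylinder Ω I)) ↔
      MemLp (fun p : ℝ × Euc N => F (join p.1 p.2)) p
        ((volume.restrict I).prod (volume.restrict Ω)) := by
  rw [← (measurePreserving_joinEquiv_restrict Ω I).map_eq]
  exact (joinEquiv N).memLp_map_measure_iff

theorem aestronglyMeasurable_slice {Y : Type*} [TopologicalSpace Y] {F : Euc (N + 1) → Y}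
    (hF : AEStronglyMeasurable F (volume.restrict (cylinder Ω I))) :
    ∀ᵐ t ∂(volume.restrict I), AEStronglyMeasurable (fun x => F (join t x)) (volume.restrict Ω) :=
  (hF.comp_measurePreserving (measurePreserving_joinEquiv_restrict Ω I)).prodMk_left

theorem ae_slice {P : Euc (N + 1) → Prop} (h : ∀ᵐ z ∂(volume.restrict (cylinder Ω I)), P z) :
    ∀ᵐ t ∂(volume.restrict I), ∀ᵐ x ∂(volume.restrict Ω), P (join t x) :=
  Measure.ae_ae_of_ae_prod
    ((measurePreserving_joinEquiv_restrict Ω I).quasiMeasurePreserving.ae h)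

theorem memLp_slice {F : Euc (N + 1) → ℝ} (hF : MemLp F 2 (volume.restrict (cylinder Ω I))) :
    ∀ᵐ t ∂(volume.restrict I), MemLp (fun x => F (join t x)) 2 (volume.restrict Ω) := by
  filter_upwards [aestronglyMeasurable_slice hF.aestronglyMeasurable,
    (integrable_cylinder_iff.1 hF.integrable_sq).prod_right_ae] with t h1 h2
  exact (memLp_two_iff_integrable_sq h1).2 h2

/-- Used to pull back statements that hold a.e. on Ω: the preimage of a null set is null by Fubini.
-/
theorem quasiMeasurePreserving_spacePart :
    Measure.QuasiMeasurePreserving (spacePart : Euc (N + 1) → Euc N)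
      (volume.restrict (cylinder Ω I)) (volume.restrict Ω) := by
  have h := (Measure.quasiMeasurePreserving_snd (μ := volume.restrict I)
    (ν := volume.restrict Ω)).comp
    (measurePreserving_joinEquiv_restrict Ω I).symm.quasiMeasurePreserving
  convert h using 1
  funext z
  have : (joinEquiv N).symm z = (z (Fin.last N), spacePart z) := by
    rw [MeasurableEquiv.symm_apply_eq]
    exact (join_spacePart z).symm
  simp [this]

theorem memLp_comp_spacePart [IsFiniteMeasure (volume.restrict I)] {f : Euc N → ℝ}
    (hf : MemLp f 2 (volume.restrict Ω)) :
    MemLp (fun z => f (spacePart z)) 2 (volume.restrict (cylinder Ω I)) := by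
  rw [memLp_cylinder_iff]
  simpa only [spacePart_join] using hf.comp_snd (volume.restrict I)

theorem integral_cylinder_comp_spacePart (f : Euc N → ℝ) :
    ∫ z in cylinder Ω I, f (spacePart z) = (volume.real I) * ∫ x in Ω, f x := by
  rw [integral_cylinder]
  simp only [spacePart_join]
  rw [integral_fun_snd]
  simp

end Join

/-! ### Slices and products of test functions -/

section Slices

variable {N : ℕ} {Ω : Set (Euc N)} {I : Set ℝ} {φ : Euc (N + 1) → ℝ}

theorem join_add_smul_castSucc (t : ℝ) (x : Euc N) (s : ℝ) (j : Fin N) :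
    join t x + s • EuclideanSpace.single j.castSucc (1 : ℝ)
      = join t (x + s • EuclideanSpace.single j (1 : ℝ)) := by
  ext i
  induction i using Fin.lastCases with
  | last => simp [join_last, (Fin.castSucc_lt_last j).ne']
  | cast i => simp [join_castSucc]

theorem join_add_smul_last (t : ℝ) (x : Euc N) (s : ℝ) :
    join t x + s • EuclideanSpace.single (Fin.last N) (1 : ℝ) = join (t + s) x := by
  ext i
  induction i using Fin.lastCases with
  | last => simp [join_last]
  | cast i => simp [join_castSucc, (Fin.castSucc_lt_last i).ne]

theorem IsTest.differentiable {Ω : Set (Euc N)} {ψ : Euc N → ℝ} (h : IsTest Ω ψ) :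
    Differentiable ℝ ψ := h.smooth.differentiable (by simp)

theorem IsTest.slice (hφ : IsTest (cylinder Ω I) φ) (t : ℝ) :
    IsTest Ω fun x => φ (join t x) := by
  have hc : ContDiff ℝ ∞ fun x : Euc N => join t x :=
    contDiff_join.comp (contDiff_const.prodMk contDiff_id)
  have hs : tsupport (fun x => φ (join t x)) ⊆ (fun x => join t x) ⁻¹' tsupport φ :=
    tsupport_comp_subset_preimage φ hc.continuous
  refine ⟨hφ.smooth.comp hc, ?_, fun x hx => (join_mem_cylinder.1 (hφ.support_subset (hs hx))).2⟩
  refine IsCompact.of_isClosed_subset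
    (hφ.compact.isCompact.image contDiff_spacePart.continuous) (isClosed_tsupport _) fun x hx => ?_
  exact ⟨join t x, hs hx, spacePart_join t x⟩

theorem IsTest.partialDeriv_slice (hφ : IsTest (cylinder Ω I) φ) (t : ℝ) (j : Fin N) (x : Euc N) :
    partialDeriv j (fun x => φ (join t x)) x = partialDeriv j.castSucc φ (join t x) := by
  rw [partialDeriv, partialDeriv, ← ((hφ.slice t).differentiable x).lineDeriv_eq_fderiv,
    ← (hφ.differentiable _).lineDeriv_eq_fderiv, lineDeriv, lineDeriv]
  simp only [join_add_smul_castSucc]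

theorem IsTest.hasDerivAt_last (hφ : IsTest (cylinder Ω I) φ) (t : ℝ) (x : Euc N) :
    HasDerivAt (fun t => φ (join t x)) (partialDeriv (Fin.last N) φ (join t x)) t := by
  have h := (hφ.differentiable (join t x)).hasFDerivAt.hasLineDerivAt
    (EuclideanSpace.single (Fin.last N) (1 : ℝ))
  rw [HasLineDerivAt] at h
  simp only [join_add_smul_last] at h
  -- The line derivative is taken at parameter 0; writing 0 as t - t lets a translation move it to
  -- t.
  have h' := (show HasDerivAt (fun s => φ (join (t + s) x))
    (partialDeriv (Fin.last N) φ (join t x)) (t - t) by rw [sub_self]; exact h).comp_sub_const t t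
  simpa using h'

/-- Along the line over x the integrand is the derivative of a compactly supported function and
vanishes outside I. -/
theorem IsTest.integral_last_eq_zero (hφ : IsTest (cylinder Ω I) φ) (x : Euc N) :
    ∫ t in I, partialDeriv (Fin.last N) φ (join t x) = 0 := by
  have hjc : Continuous fun t : ℝ => join t x :=
    contDiff_join.continuous.comp (continuous_id.prodMk continuous_const)
  have hsupp : ∀ F : Euc (N + 1) → ℝ, HasCompactSupport F →
      HasCompactSupport fun t => F (join t x) := by
    intro F hF
    have hl : Continuous fun z : Euc (N + 1) => z (Fin.last N) :=
      continuous_apply_last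
    refine IsCompact.of_isClosed_subset (hF.isCompact.image hl) (isClosed_tsupport _) fun t ht => ?_
    exact ⟨join t x, tsupport_comp_subset_preimage F hjc ht, join_last t x⟩
  rw [setIntegral_eq_integral_of_forall_compl_eq_zero]
  · refine integral_eq_zero_of_hasDerivAt_of_integrable (f := fun t => φ (join t x))
      (fun t => hφ.hasDerivAt_last t x) ?_ ?_
    · exact ((hφ.continuous_partialDeriv _).comp hjc).integrable_of_hasCompactSupport
        (hsupp _ (hφ.hasCompactSupport_partialDeriv _))
    · exact (hφ.smooth.continuous.comp hjc).integrable_of_hasCompactSupport (hsupp _ hφ.compact)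
  · intro t ht
    have h1 : join t x ∉ tsupport φ := fun h => ht (join_mem_cylinder.1 (hφ.support_subset h)).1
    rw [partialDeriv, image_eq_zero_of_notMem_tsupport fun h => h1 (tsupport_fderiv_subset ℝ h)]
    rfl

/-- These product test functions separate the variables, which localizes weak identities on the
cylinder in t. -/
theorem IsTest.mul_slice {ψ : Euc N → ℝ} (hψ : IsTest Ω ψ) {η : ℝ → ℝ} (hη : ContDiff ℝ ∞ η)
    (hηc : HasCompactSupport η) (hηI : tsupport η ⊆ I) :
    IsTest (cylinder Ω I) fun z => η (z (Fin.last N)) * ψ (spacePart z) := by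
  have hl : ContDiff ℝ ∞ fun z : Euc (N + 1) => z (Fin.last N) :=
    contDiff_euclidean.1 contDiff_id (Fin.last N)
  have h1 : tsupport (fun z : Euc (N + 1) => η (z (Fin.last N)) * ψ (spacePart z)) ⊆
      (fun z => z (Fin.last N)) ⁻¹' tsupport η :=
    (tsupport_mul_subset_left (f := fun z : Euc (N + 1) => η (z (Fin.last N)))).trans
      (tsupport_comp_subset_preimage η hl.continuous)
  have h2 : tsupport (fun z : Euc (N + 1) => η (z (Fin.last N)) * ψ (spacePart z)) ⊆
      spacePart ⁻¹' tsupport ψ :=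
    (tsupport_mul_subset_right (f := fun z : Euc (N + 1) => η (z (Fin.last N)))).trans
      (tsupport_comp_subset_preimage ψ contDiff_spacePart.continuous)
  refine ⟨(hη.comp hl).mul (hψ.smooth.comp contDiff_spacePart), ?_,
    fun z hz => ⟨hψ.support_subset (h2 hz), hηI (h1 hz)⟩⟩
  refine IsCompact.of_isClosed_subset
    ((hηc.isCompact.prod hψ.compact.isCompact).image contDiff_join.continuous)
    (isClosed_tsupport _) fun z hz => ?_
  exact ⟨(z (Fin.last N), spacePart z), ⟨h1 hz, h2 hz⟩, join_spacePart z⟩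

end Slices

theorem isTest_zero {N : ℕ} (Ω : Set (Euc N)) : IsTest Ω fun _ => 0 :=
  ⟨contDiff_const, HasCompactSupport.zero, by simp [tsupport]⟩

/-! ### Weak derivatives on the cylinder and on its slices -/

section WeakPartialCylinder

variable {N : ℕ} {Ω : Set (Euc N)} {I : Set ℝ}

/-- Fubini: each slice of a test function is a test function on Ω. Finiteness of |I| puts the
extended functions in L². -/
theorem HasWeakPartial.comp_spacePart [IsFiniteMeasure (volume.restrict I)] {f g : Euc N → ℝ}
    {j : Fin N} (h : HasWeakPartial Ω f j g) :
    HasWeakPartial (cylinder Ω I) (fun z => f (spacePart z)) j.castSucc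
      fun z => g (spacePart z) := by
  have hf := memLp_comp_spacePart (I := I) h.memLp_fun
  have hg := memLp_comp_spacePart (I := I) h.memLp_deriv
  refine ⟨hf, hg, fun φ hφ => ?_⟩
  rw [integral_cylinder_eq_integral_integral (integrable_mul_of_memLp_two hf (hφ.memLp_partialDeriv _ 2 _)),
    integral_cylinder_eq_integral_integral (integrable_mul_of_memLp_two hg (hφ.memLp 2 _)), ← integral_neg]
  congr 1 with t
  simpa only [spacePart_join, hφ.partialDeriv_slice] using h.integral_eq _ (hφ.slice t)

theorem hasWeakPartial_last_comp_spacePart [IsFiniteMeasure (volume.restrict I)] {f : Euc N → ℝ}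
    (hf : MemLp f 2 (volume.restrict Ω)) :
    HasWeakPartial (cylinder Ω I) (fun z => f (spacePart z)) (Fin.last N) 0 := by
  have hf' := memLp_comp_spacePart (I := I) hf
  refine ⟨hf', MemLp.zero, fun φ hφ => ?_⟩
  have hi := integrable_cylinder_iff.1 (integrable_mul_of_memLp_two hf' (hφ.memLp_partialDeriv (Fin.last N) 2 _))
  rw [integral_cylinder, integral_prod_symm _ hi]
  simp [spacePart_join, integral_const_mul, hφ.integral_last_eq_zero]

/-- Weak differentiability on `Ω` can be tested on a countable set of test functions. -/
theorem exists_countable_isTest (Ω : Set (Euc N)) (j : Fin N) :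
    ∃ D : Set (Euc N → ℝ), D.Countable ∧ (∀ ψ ∈ D, IsTest Ω ψ) ∧
      ∀ f g : Euc N → ℝ, MemLp f 2 (volume.restrict Ω) → MemLp g 2 (volume.restrict Ω) →
        (∀ ψ ∈ D, ∫ x in Ω, (f x * partialDeriv j ψ x + g x * ψ x) = 0) →
        HasWeakPartial Ω f j g := by
  let μ : Measure (Euc N) := volume.restrict Ω
  have : Fact ((2 : ENNReal) ≠ ⊤) := ⟨by simp⟩
  have : SecondCountableTopology (Lp ℝ 2 μ) :=
    inferInstanceAs (SecondCountableTopology (Lp ℝ 2 (volume.restrict Ω)))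
  -- The weak identity sees ψ only through the pair (∂_j ψ, ψ) in L² × L². The range of this map is
  -- separable, and a countable dense part of it supplies the family `D`.
  let ι : {ψ // IsTest Ω ψ} → Lp ℝ 2 μ × Lp ℝ 2 μ := fun ψ =>
    ((ψ.2.memLp_partialDeriv j 2 μ).toLp _, (ψ.2.memLp 2 μ).toLp _)
  obtain ⟨s, hs, hsc, hds⟩ :=
    (TopologicalSpace.IsSeparable.of_separableSpace (Set.range ι)).exists_countable_dense_subset
  have : Nonempty {ψ // IsTest Ω ψ} := ⟨_, isTest_zero Ω⟩
  choose! r hr using show ∀ p ∈ s, ∃ ψ, ι ψ = p from fun p hp => hs hp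
  refine ⟨(fun p => (r p).1) '' s, hsc.image _, ?_, fun f g hf hg h0 => ⟨hf, hg, fun ψ hψ => ?_⟩⟩
  · rintro _ ⟨p, -, rfl⟩
    exact (r p).2
  -- `Λ` is the defect in the weak identity. Being continuous and zero on `s`, it vanishes on the
  -- closure, hence at every test function.
  let Λ : Lp ℝ 2 μ × Lp ℝ 2 μ → ℝ := fun p =>
    inner ℝ (hf.toLp f) p.1 + inner ℝ (hg.toLp g) p.2
  have hΛ : Continuous Λ := by fun_prop
  have e : ∀ {f h : Euc N → ℝ} (hf : MemLp f 2 μ) (hh : MemLp h 2 μ),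
      inner ℝ (hf.toLp f) (hh.toLp h) = ∫ x in Ω, f x * h x := by
    intro f h hf hh
    rw [L2.inner_def]
    refine integral_congr_ae ?_
    filter_upwards [hf.coeFn_toLp, hh.coeFn_toLp] with x h1 h2
    rw [h1, h2]
    simp [mul_comm]
  have hΛι : ∀ ψ, Λ (ι ψ)
      = (∫ x in Ω, f x * partialDeriv j ψ.1 x) + ∫ x in Ω, g x * ψ.1 x := fun ψ => by
    simp only [Λ, ι, e]
  have hsub : closure s ⊆ Λ ⁻¹' {0} := by
    refine (isClosed_singleton.preimage hΛ).closure_subset_iff.2 fun p hp => ?_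
    have h1 := h0 _ ⟨p, hp, rfl⟩
    have h2 := integral_add (integrable_mul_of_memLp_two hf ((r p).2.memLp_partialDeriv j 2 μ))
      (integrable_mul_of_memLp_two hg ((r p).2.memLp 2 μ))
    rw [h2, ← hΛι, hr p hp] at h1
    exact h1
  have h3 : Λ (ι ⟨ψ, hψ⟩) = 0 := hsub (hds ⟨_, rfl⟩)
  rw [hΛι] at h3
  linarith

/-- Almost every slice of a weakly differentiable function is weakly differentiable. -/
theorem HasWeakPartial.slice [IsFiniteMeasure (volume.restrict I)] (hI : IsOpen I)
    {F G : Euc (N + 1) → ℝ} {j : Fin N} (h : HasWeakPartial (cylinder Ω I) F j.castSucc G) :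
    ∀ᵐ t ∂(volume.restrict I),
      HasWeakPartial Ω (fun x => F (join t x)) j fun x => G (join t x) := by
  obtain ⟨D, hDc, hD, hDw⟩ := exists_countable_isTest Ω j
  have hF := memLp_cylinder_iff.1 h.memLp_fun
  have hG := memLp_cylinder_iff.1 h.memLp_deriv
  have key : ∀ ψ ∈ D, ∀ᵐ t ∂(volume.restrict I),
      ∫ x in Ω, (F (join t x) * partialDeriv j ψ x + G (join t x) * ψ x) = 0 := by
    intro ψ hψD
    have hψ := hD ψ hψD
    have hi : Integrable (fun p : ℝ × Euc N => F (join p.1 p.2) * partialDeriv j ψ p.2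
        + G (join p.1 p.2) * ψ p.2) ((volume.restrict I).prod (volume.restrict Ω)) :=
      (integrable_mul_of_memLp_two hF ((hψ.memLp_partialDeriv j 2 (volume.restrict Ω)).comp_snd _)).add
        (integrable_mul_of_memLp_two hG ((hψ.memLp 2 (volume.restrict Ω)).comp_snd _))
    have hloc : LocallyIntegrableOn (fun t => ∫ x in Ω, (F (join t x) * partialDeriv j ψ x
        + G (join t x) * ψ x)) I volume :=
      locallyIntegrableOn_of_locallyIntegrable_restrict hi.integral_prod_left.locallyIntegrable
    rw [ae_restrict_iff' hI.measurableSet]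
    -- Testing the identity on the cylinder with η(t)ψ(x), η arbitrary, makes the slice integral
    -- vanish for a.e. t. The null set depends on ψ, hence the countable `D`.
    refine hI.ae_eq_zero_of_integral_contDiff_smul_eq_zero hloc fun η hη hηc hηI => ?_
    have ht := hψ.mul_slice hη hηc hηI
    have hpd : ∀ t x, partialDeriv j.castSucc
        (fun z : Euc (N + 1) => η (z (Fin.last N)) * ψ (spacePart z)) (join t x)
        = η t * partialDeriv j ψ x := by
      intro t x
      rw [← ht.partialDeriv_slice]
      simp only [join_last, spacePart_join, partialDeriv]
      rw [fderiv_const_mul (hψ.differentiable x)]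
      rfl
    have hF' := integrable_mul_of_memLp_two h.memLp_fun (ht.memLp_partialDeriv j.castSucc 2 _)
    have hG' := integrable_mul_of_memLp_two h.memLp_deriv (ht.memLp 2 _)
    have e := h.integral_eq _ ht
    rw [← add_eq_zero_iff_eq_neg] at e
    have e2 := integral_add hF' hG'
    have hs : Integrable (fun z => F z * partialDeriv j.castSucc
        (fun z : Euc (N + 1) => η (z (Fin.last N)) * ψ (spacePart z)) z
        + G z * (η (z (Fin.last N)) * ψ (spacePart z))) (volume.restrict (cylinder Ω I)) :=
      hF'.add hG'
    rw [← e2, integral_cylinder_eq_integral_integral hs] at e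
    rw [← setIntegral_eq_integral_of_forall_compl_eq_zero (s := I) fun t ht => by
      rw [image_eq_zero_of_notMem_tsupport fun h => ht (hηI h), zero_smul], ← e]
    congr 1 with t
    rw [smul_eq_mul, ← integral_const_mul]
    congr 1 with x
    rw [hpd, join_last, spacePart_join]
    ring
  filter_upwards [memLp_slice h.memLp_fun, memLp_slice h.memLp_deriv,
    (ae_ball_iff hDc).2 key] with t h1 h2 h3
  exact hDw _ _ h1 h2 h3

end WeakPartialCylinder

/-! ### The cylindrical extension and its energy -/

section Lift

variable {N Q n : ℕ} {Ω : Set (Euc N)} {I : Set ℝ} {u : Euc N → AQ Q n}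

theorem IsPartialBound.lift [IsFiniteMeasure (volume.restrict I)] {j : Fin N} {φ : Euc N → ℝ}
    (h : IsPartialBound Ω u j φ) :
    IsPartialBound (cylinder Ω I) (lift u) j.castSucc fun z => φ (spacePart z) := by
  refine ⟨memLp_comp_spacePart h.memLp, quasiMeasurePreserving_spacePart.ae h.nonneg,
    fun T => ?_⟩
  obtain ⟨g, hg, hgφ⟩ := h.bound T
  exact ⟨_, hg.comp_spacePart, quasiMeasurePreserving_spacePart.ae hgφ⟩

theorem MemW12Q.isPartialBound_lift_last [IsFiniteMeasure (volume.restrict I)]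
    (hu : MemW12Q Ω u) :
    IsPartialBound (cylinder Ω I) (QValued.lift u) (Fin.last N) fun _ => 0 :=
  ⟨MemLp.zero, Eventually.of_forall fun _ => le_rfl, fun T =>
    ⟨_, hasWeakPartial_last_comp_spacePart (hu.memW12 T).memLp, by simp⟩⟩

theorem MemW12Q.lift [IsFiniteMeasure (volume.restrict I)] (hu : MemW12Q Ω u) :
    MemW12Q (cylinder Ω I) (QValued.lift u) := by
  refine ⟨hu.measurable.comp_quasiMeasurePreserving quasiMeasurePreserving_spacePart,
    fun T => ⟨memLp_comp_spacePart (hu.memW12 T).memLp, fun j => ?_⟩, fun j => ?_⟩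
  · induction j using Fin.lastCases with
    | last => exact ⟨_, hasWeakPartial_last_comp_spacePart (hu.memW12 T).memLp⟩
    | cast j =>
      obtain ⟨g, hg⟩ := (hu.memW12 T).exists_weakPartial j
      exact ⟨_, hg.comp_spacePart⟩
  · induction j using Fin.lastCases with
    | last => exact ⟨_, hu.isPartialBound_lift_last⟩
    | cast j =>
      obtain ⟨φ, hφ⟩ := hu.exists_bound j
      exact ⟨_, hφ.lift⟩

/-- Only this inequality is needed: admissible bounds for the extension suffice, with no need to
identify its minimal ones. -/
theorem MemW12Q.energy_lift_le [IsFiniteMeasure (volume.restrict I)] (hΩ : IsOpen Ω)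
    (hI : IsOpen I) (hu : MemW12Q Ω u) :
    energy (cylinder Ω I) (QValued.lift u) ≤ volume.real I * energy Ω u := by
  have h := hu.lift.energy_le (isOpen_cylinder hΩ hI)
    (ψ := Fin.lastCases (fun _ => 0) fun j z => normPartial Ω u j (spacePart z)) fun j => by
      induction j using Fin.lastCases with
      | last => simpa using hu.isPartialBound_lift_last
      | cast j => simpa using (hu.isMinimalPartialBound_normPartial hΩ j).isBound.lift
  refine h.trans_eq ?_
  simp only [Fin.sum_univ_castSucc, Fin.lastCases_castSucc, Fin.lastCases_last]
  simpa [energy] using integral_cylinder_comp_spacePart fun x => ∑ j, normPartial Ω u j x ^ 2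

end Lift

/-! ### Slicing competitors and comparing energies -/

section SliceQ

variable {N Q n : ℕ} {Ω : Set (Euc N)} {I : Set ℝ}

/-- Ω may have infinite measure, so constants need not be in L²; here 𝒢(S, T) ≤ 𝒢(u, S) + 𝒢(u, T).
-/
theorem MemW12Q.memLp_const_G {u : Euc N → AQ Q n} (hu : MemW12Q Ω u) (S T : AQ Q n) :
    MemLp (fun _ => AQ.G S T) 2 (volume.restrict Ω) := by
  refine ((hu.memW12 S).memLp.add (hu.memW12 T).memLp).mono aestronglyMeasurable_const
    (Eventually.of_forall fun x => ?_)
  simp only [Pi.add_apply, Real.norm_eq_abs]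
  rw [abs_of_nonneg (AQ.G_nonneg _ _),
    abs_of_nonneg (add_nonneg (AQ.G_nonneg _ _) (AQ.G_nonneg _ _))]
  exact dist_triangle_left S T (u x)

/-- Almost every slice of a `Q`-valued Sobolev map is a Sobolev map, with the sliced bounds. -/
theorem MemW12Q.slice [IsFiniteMeasure (volume.restrict I)] (hI : IsOpen I)
    {u : Euc N → AQ Q n} (hu : MemW12Q Ω u) {V : Euc (N + 1) → AQ Q n}
    (hV : MemW12Q (cylinder Ω I) V) {Φ : Fin N → Euc (N + 1) → ℝ}
    (hΦ : ∀ j, IsPartialBound (cylinder Ω I) V j.castSucc (Φ j)) :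
    ∀ᵐ t ∂(volume.restrict I), MemW12Q Ω (fun x => V (join t x)) ∧
      ∀ j, IsPartialBound Ω (fun x => V (join t x)) j fun x => Φ j (join t x) := by
  set S := TopologicalSpace.denseSeq (AQ Q n)
  have hS : Dense (Set.range S) := TopologicalSpace.denseRange_denseSeq _
  choose g hg hgΦ using fun j => (hΦ j).bound
  have h1 : ∀ᵐ t ∂(volume.restrict I), ∀ j k,
      HasWeakPartial Ω (fun x => AQ.G (V (join t x)) (S k)) j fun x => g j (S k) (join t x) :=
    ae_all_iff.2 fun j => ae_all_iff.2 fun k => (hg j (S k)).slice hI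
  have h2 : ∀ᵐ t ∂(volume.restrict I), ∀ j k, ∀ᵐ x ∂(volume.restrict Ω),
      |g j (S k) (join t x)| ≤ Φ j (join t x) :=
    ae_all_iff.2 fun j => ae_all_iff.2 fun k => ae_slice (hgΦ j (S k))
  have h3 : ∀ᵐ t ∂(volume.restrict I), ∀ j, ∀ᵐ x ∂(volume.restrict Ω), 0 ≤ Φ j (join t x) :=
    ae_all_iff.2 fun j => ae_slice (hΦ j).nonneg
  have h4 : ∀ᵐ t ∂(volume.restrict I), ∀ j,
      MemLp (fun x => Φ j (join t x)) 2 (volume.restrict Ω) :=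
    ae_all_iff.2 fun j => memLp_slice (hΦ j).memLp
  filter_upwards [h1, h2, h3, h4, aestronglyMeasurable_slice hV.measurable,
    memLp_slice (hV.memW12 (S 0)).memLp] with t k1 k2 k3 k4 k5 k6
  -- One T, namely `S 0`, was sliced; every other T differs from it by the constant 𝒢(S 0, T), so
  -- the null set of t does not depend on T.
  have hm : ∀ T, MemLp (fun x => AQ.G (V (join t x)) T) 2 (volume.restrict Ω) := by
    intro T
    have hmeas : AEStronglyMeasurable (fun x => AQ.G (V (join t x)) T) (volume.restrict Ω) :=
      (continuous_id.dist continuous_const).comp_aestronglyMeasurable k5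
    refine (k6.add (hu.memLp_const_G (S 0) T)).mono hmeas (Eventually.of_forall fun x => ?_)
    simp only [Pi.add_apply, Real.norm_eq_abs]
    rw [abs_of_nonneg (AQ.G_nonneg _ _),
      abs_of_nonneg (add_nonneg (AQ.G_nonneg _ _) (AQ.G_nonneg _ _))]
    exact dist_triangle (V (join t x)) (S 0) T
  have hb : ∀ j, IsPartialBound Ω (fun x => V (join t x)) j fun x => Φ j (join t x) := by
    refine fun j => IsPartialBound.of_dense hS hm (k4 j) (k3 j) ?_
    rintro _ ⟨k, rfl⟩
    exact ⟨_, k1 j k, k2 j k⟩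
  refine ⟨⟨k5, fun T => ⟨hm T, fun j => ?_⟩, fun j => ⟨_, hb j⟩⟩, hb⟩
  obtain ⟨w, hw, -⟩ := (hb j).bound T
  exact ⟨w, hw⟩

theorem eLpNorm_two_sq {α : Type*} [MeasurableSpace α] (μ : Measure α) (f : α → ℝ) :
    eLpNorm f 2 μ ^ 2 = ∫⁻ x, ‖f x‖ₑ ^ 2 ∂μ := by
  simpa using eLpNorm_nnreal_pow_eq_lintegral (f := f) (μ := μ) (p := 2) (by simp)

theorem eLpNorm_cylinder_sq {h : Euc (N + 1) → ℝ}
    (hh : AEStronglyMeasurable h (volume.restrict (cylinder Ω I))) :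
    eLpNorm h 2 (volume.restrict (cylinder Ω I)) ^ 2
      = ∫⁻ t in I, eLpNorm (fun x => h (join t x)) 2 (volume.restrict Ω) ^ 2 := by
  have hmp := measurePreserving_joinEquiv_restrict Ω I
  simp only [eLpNorm_two_sq]
  rw [← hmp.lintegral_comp_emb (joinEquiv N).measurableEmbedding, lintegral_prod]
  · rfl
  · exact (hh.comp_measurePreserving hmp).enorm.pow_const 2

theorem aemeasurable_eLpNorm_slice {h : Euc (N + 1) → ℝ}
    (hh : AEStronglyMeasurable h (volume.restrict (cylinder Ω I))) :
    AEMeasurable (fun t => eLpNorm (fun x => h (join t x)) 2 (volume.restrict Ω) ^ 2)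
      (volume.restrict I) := by
  simp only [eLpNorm_two_sq]
  exact AEMeasurable.lintegral_prod_right' (f := fun p : ℝ × Euc N => ‖h (join p.1 p.2)‖ₑ ^ 2)
    ((hh.comp_measurePreserving
      (measurePreserving_joinEquiv_restrict Ω I)).enorm.pow_const 2)

/-- Finitely many sequences tending to zero in `L²` of a cylinder have a common subsequence along
which almost all slices tend to zero in `L²`. -/
theorem exists_subseq_tendsto_eLpNorm_slice {ι : Type*} [Fintype ι]
    {h : ι → ℕ → Euc (N + 1) → ℝ}
    (hm : ∀ i k, AEStronglyMeasurable (h i k) (volume.restrict (cylinder Ω I)))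
    (h0 : ∀ i, Tendsto (fun k => eLpNorm (h i k) 2 (volume.restrict (cylinder Ω I))) atTop (𝓝 0)) :
    ∃ s : ℕ → ℕ, ∀ᵐ t ∂(volume.restrict I), ∀ i,
      Tendsto (fun k => eLpNorm (fun x => h i (s k) (join t x)) 2 (volume.restrict Ω))
        atTop (𝓝 0) := by
  have ha : Tendsto (fun k => ∑ i, eLpNorm (h i k) 2 (volume.restrict (cylinder Ω I)) ^ 2)
      atTop (𝓝 0) := by
    have := tendsto_finsetSum (Finset.univ : Finset ι) fun i _ =>
      ENNReal.Tendsto.pow (n := 2) (h0 i)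
    simpa using this
  -- Choosing indices with summable squared norms makes the series of slice norms integrable in t,
  -- hence finite for a.e. t, so its terms tend to 0.
  obtain ⟨ε, hε, hεs⟩ := ENNReal.exists_pos_sum_of_countable' one_ne_zero ℕ
  choose s hs using fun k => (ha.eventually (ge_mem_nhds (hε k))).exists
  refine ⟨s, ?_⟩
  let b : ℕ → ℝ → ENNReal := fun k t =>
    ∑ i, eLpNorm (fun x => h i (s k) (join t x)) 2 (volume.restrict Ω) ^ 2
  have hb : ∀ k, AEMeasurable (b k) (volume.restrict I) := fun k =>
    Finset.aemeasurable_fun_sum _ fun i _ => aemeasurable_eLpNorm_slice (hm i (s k))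
  have hbint : ∫⁻ t in I, ∑' k, b k t ≠ ⊤ := by
    rw [lintegral_tsum hb]
    refine ne_top_of_le_ne_top ENNReal.one_ne_top
      ((ENNReal.tsum_le_tsum fun k => ?_).trans hεs.le)
    refine le_trans (le_of_eq ?_) (hs k)
    rw [lintegral_finsetSum' _ fun i _ => aemeasurable_eLpNorm_slice (hm i (s k))]
    exact Finset.sum_congr rfl fun i _ => (eLpNorm_cylinder_sq (hm i (s k))).symm
  filter_upwards [ae_lt_top' (AEMeasurable.tsum hb) hbint] with t ht i
  have h1 : Tendsto (fun k => b k t) atTop (𝓝 0) :=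
    ENNReal.tendsto_atTop_zero_of_tsum_ne_top ht.ne
  have h2 : Tendsto (fun k => eLpNorm (fun x => h i (s k) (join t x)) 2 (volume.restrict Ω) ^ 2)
      atTop (𝓝 0) :=
    tendsto_of_tendsto_of_tendsto_of_le_of_le tendsto_const_nhds h1 (fun _ => zero_le)
      fun k => Finset.single_le_sum (f := fun i =>
        eLpNorm (fun x => h i (s k) (join t x)) 2 (volume.restrict Ω) ^ 2)
        (fun _ _ => zero_le) (Finset.mem_univ i)
  have h3 := h2.ennrpow_const (1 / 2)
  have e : ∀ y : ENNReal, (y ^ 2) ^ (1 / 2 : ℝ) = y := fun y => by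
    rw [← ENNReal.rpow_natCast, ← ENNReal.rpow_mul]
    norm_num
  simpa only [e, ENNReal.zero_rpow_of_pos (one_half_pos : (0 : ℝ) < 1 / 2)] using h3

/-- Almost every slice of a `W_0^{1,2}` function on a cylinder is a `W_0^{1,2}` function. -/
theorem MemW12Zero.slice [IsFiniteMeasure (volume.restrict I)] (hI : IsOpen I)
    {F : Euc (N + 1) → ℝ} (hF : MemW12Zero (cylinder Ω I) F) :
    ∀ᵐ t ∂(volume.restrict I), MemW12Zero Ω fun x => F (join t x) := by
  obtain ⟨hF2, g, hg, φ, hφ, hφF, hφg⟩ := hF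
  -- `none` carries the error of the functions and `some j` that of the j-th spatial derivatives, so
  -- one subsequence serves all of them.
  let h : Option (Fin N) → ℕ → Euc (N + 1) → ℝ := fun i k z =>
    i.elim (φ k z - F z) fun j => partialDeriv j.castSucc (φ k) z - g j.castSucc z
  obtain ⟨s, hs⟩ := exists_subseq_tendsto_eLpNorm_slice (Ω := Ω) (I := I) (h := h)
    (fun i k => by
      cases i with
      | none => exact (((hφ k).memLp 2 _).sub hF2).aestronglyMeasurable
      | some j =>
        exact (((hφ k).memLp_partialDeriv _ 2 _).sub (hg j.castSucc).memLp_deriv).aestronglyMeasurable)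
    (fun i => by
      cases i with
      | none => exact hφF
      | some j => exact hφg j.castSucc)
  have hw : ∀ᵐ t ∂(volume.restrict I), ∀ j : Fin N,
      HasWeakPartial Ω (fun x => F (join t x)) j fun x => g j.castSucc (join t x) :=
    ae_all_iff.2 fun j => (hg j.castSucc).slice hI
  filter_upwards [hs, hw, memLp_slice hF2] with t h1 h2 h3
  refine ⟨h3, _, h2, fun k x => φ (s k) (join t x), fun k => (hφ (s k)).slice t, h1 none,
    fun j => ?_⟩
  simp only [(hφ _).partialDeriv_slice]
  exact h1 (some j)

theorem memW12Zero_zero (Ω : Set (Euc N)) : MemW12Zero Ω fun _ => 0 := by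
  have hd : ∀ (j : Fin N) x, partialDeriv j (fun _ => 0) x = 0 := fun j x => by
    simp [partialDeriv]
  refine ⟨MemLp.zero, fun _ _ => 0, fun j => ⟨MemLp.zero, MemLp.zero, by simp⟩,
    fun _ _ => 0, fun _ => isTest_zero Ω, ?_, fun j => ?_⟩
  · simp
  · simp [hd]

/-- Among the maps with the boundary values of a cylindrical extension of a minimizer, the energy
is at least that of the minimizer times the height of the cylinder. -/
theorem IsDirichletMinimizing.le_energy_cylinder [IsFiniteMeasure (volume.restrict I)]
    (hΩ : IsOpen Ω) (hI : IsOpen I) {u : Euc N → AQ Q n} (hu : IsDirichletMinimizing Ω u)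
    {V : Euc (N + 1) → AQ Q n} (hV : MemW12Q (cylinder Ω I) V)
    (h0 : MemW12Zero (cylinder Ω I) fun z => AQ.G (lift u z) (V z)) :
    volume.real I * energy Ω u ≤ energy (cylinder Ω I) V := by
  have hO := isOpen_cylinder hΩ hI
  have hΦ := fun j : Fin (N + 1) => (hV.isMinimalPartialBound_normPartial hO j).isBound
  have hint : Integrable
      (fun z => ∑ j : Fin N, normPartial (cylinder Ω I) V j.castSucc z ^ 2)
      (volume.restrict (cylinder Ω I)) :=
    integrable_finsetSum _ fun j _ => (hΦ j.castSucc).memLp.integrable_sq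
  have hslice : ∀ᵐ t ∂(volume.restrict I), energy Ω u
      ≤ ∫ x in Ω, ∑ j : Fin N, normPartial (cylinder Ω I) V j.castSucc (join t x) ^ 2 := by
    filter_upwards [hu.memW12Q.slice hI hV fun j => hΦ j.castSucc, h0.slice hI] with t h1 h2
    -- The slice is a competitor for u, and the sliced bounds of V dominate its energy.
    refine (hu.isGLB.1 ⟨_, h1.1, ?_, rfl⟩).trans (h1.1.energy_le hΩ h1.2)
    simpa only [lift, spacePart_join] using h2
  calc volume.real I * energy Ω u = ∫ _ in I, energy Ω u := by simp
    _ ≤ ∫ t in I, ∫ x in Ω, ∑ j : Fin N,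
          normPartial (cylinder Ω I) V j.castSucc (join t x) ^ 2 :=
        integral_mono_ae (integrable_const _)
          (integrable_cylinder_iff.1 hint).integral_prod_left hslice
    _ = ∫ z in cylinder Ω I, ∑ j : Fin N, normPartial (cylinder Ω I) V j.castSucc z ^ 2 :=
        (integral_cylinder_eq_integral_integral hint).symm
    _ ≤ energy (cylinder Ω I) V := by
        refine integral_mono hint (hV.integrable_energy hO) fun z => ?_
        simp only [Fin.sum_univ_castSucc]
        exact le_add_of_nonneg_right (sq_nonneg _)

end SliceQ

end QValued

theorem mainTheorem10 (N n Q : ℕ) (hN : 1 ≤ N)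
    (Ω : Set (EuclideanSpace ℝ (Fin N))) (hΩ : IsOpen Ω)
    (u : EuclideanSpace ℝ (Fin N) → QValued.AQ Q n)
    (hu : QValued.IsDirichletMinimizing Ω u)
    (a b : ℝ) (hab : a < b) :
    QValued.MemW12Q (QValued.cylinder Ω (Set.Ioo a b)) (QValued.lift u) ∧
      QValued.IsDirichletMinimizing (QValued.cylinder Ω (Set.Ioo a b)) (QValued.lift u) := by
  have hU : QValued.MemW12Q (QValued.cylinder Ω (Set.Ioo a b)) (QValued.lift u) := hu.memW12Q.lift
  -- Any lower bound lies below the energy of U because U is its own competitor: 𝒢(U, U) = 0.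
  refine ⟨hU, hU, ?_, fun e he => he ⟨_, hU, ?_, rfl⟩⟩
  · rintro _ ⟨V, hV, h0, rfl⟩
    exact (hu.memW12Q.energy_lift_le hΩ isOpen_Ioo).trans
      (hu.le_energy_cylinder hΩ isOpen_Ioo hV h0)
  · simpa only [QValued.AQ.G_self] using QValued.memW12Zero_zero _
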